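/- Consider the deterministic imperative language with statements $x:=e$, $s_1;s_2$, $\mathsf{if}\ b\ \mathsf{then}\ s_1\ \mathsf{else}\ s_2$, $\mathsf{while}\ b\ \mathsf{do}\ s$, integer expressions built from variables, $0$, $1$, $+$, $-$, and Boolean expressions built from $\mathsf t,\mathsf f,\neg,\wedge,<,==$. A state assigns integers to the variables and also holds an integer $e_t$ and a Boolean $b_t$, into which expressions write their value. For a set $C$ of programs (all statements, all integer expressions or all Boolean expressions) and a set $P$ of states, let $[\![C]\!](P)$ be the set of all final states of terminating runs of programs $c\in C$ from states in $P$ (the divergence-agnostic program-agnostic semantics); in the divergence-aware version, nonterminating runs contribute an extra value $\uparrow$, and $\uparrow$ as an input gives $\uparrow$. A set of programs is inductively defined if it is the language of a nonterminal of a regular tree grammar over the constructors of the language. An unrealizability triple $\{P\}\,C\,\{Q\}$ means $[\![C]\!](P)\subseteq Q$. Assertions are sets of states (of possibly diverged states, in the divergence-aware version), and may depend on auxiliary variables ranging over an arbitrary nonempty set, in which case the inclusion is required for all their values. A judgment $\Gamma\vdash t$ is true if $t$ holds whenever all triples in the set $\Gamma$ hold. A compositional While-rule is given by a function $\varphi$,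 and infers $$\Gamma\vdash\{P\}\ (\mathsf{while}\ B\ \mathsf{do}\ S)\ \{\varphi(\mathrm{vars}(B),\mathrm{vars}(S),P,P_B,P_S,Q_B,Q_S)\}$$ from $\Gamma\vdash\{P_B\}\,B\,\{Q_B\}$ and $\Gamma\vdash\{P_S\}\,S\,\{Q_S\}$, where $B$ and $S$ are inductively defined and $\mathsf{while}\ B\ \mathsf{do}\ S$ is the set of all loops with guard in $B$ and body in $S$. Consider finite derivations that use the following rules: one such While-rule, whose premises may be any true judgments; the grammar-disjunction rule (from $\Gamma\vdash\{P\}\,C_1\,\{Q\}$ and $\Gamma\vdash\{P\}\,C_2\,\{Q\}$ infer $\Gamma\vdash\{P\}\,C_1\cup C_2\,\{Q\}$, for inductively defined $C_1,C_2$); weakening (strengthen $P$, weaken $Q$); use of a hypothesis in $\Gamma$; and any set of further structural rules of the form: for every $\Gamma$ and every inductively defined set $C$ of loops, from $\Gamma\vdash\{P_i\}\,C\,\{Q_i\}$ for $i=1,\dots,k$ infer $\Gamma\vdash\{P\}\,C\,\{Q\}$, where the assertions $P_i,Q_i,P,Q$ are fixed independently of $\Gamma$ and $C$. The system is sound if every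 derivable judgment is true, and relatively complete if every true judgment $\Gamma\vdash\{P\}\ (\mathsf{while}\ B\ \mathsf{do}\ S)\ \{Q\}$ with $B,S$ inductively defined is derivable. **Theorem.** For neither the divergence-agnostic nor the divergence-aware program-agnostic semantics is there a compositional While-rule $\varphi$ and a set of further structural rules such that the resulting system is both sound and relatively complete. In particular, there is no sound and relatively complete compositional While-rule for program-agnostic triples, even when finitely many applications of grammar disjunction and weakening are allowed. -/

import Mathlib

namespace Imp

/-! ### Programs -/

/-- The sorts of terms: statements, integer expressions and Boolean expressions. -/
inductive Ty
  | stmt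
  | exp
  | bexp

/-- Program variables: a countably infinite supply `x₀, x₁, x₂, …`. -/
abbrev Var := ℕ

/-- Terms of the imperative language, indexed by their sort. -/
inductive Term : Ty → Type
  | var (x : Var) : Term .exp
  | zero : Term .exp
  | one : Term .exp
  | add (e₁ e₂ : Term .exp) : Term .exp
  | sub (e₁ e₂ : Term .exp) : Term .exp
  | tt : Term .bexp
  | ff : Term .bexp
  | not (b : Term .bexp) : Term .bexp
  | and (b₁ b₂ : Term .bexp) : Term .bexp
  | lt (e₁ e₂ : Term .exp) : Term .bexp
  | eq (e₁ e₂ : Term .exp) : Term .bexp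
  | assign (x : Var) (e : Term .exp) : Term .stmt
  | seq (s₁ s₂ : Term .stmt) : Term .stmt
  | ite (b : Term .bexp) (s₁ s₂ : Term .stmt) : Term .stmt
  | loop (b : Term .bexp) (s : Term .stmt) : Term .stmt

/-- The variables that occur in a term. -/
def Term.vars : {τ : Ty} → Term τ → Set Var
  | _, .var x => {x}
  | _, .zero => ∅
  | _, .one => ∅
  | _, .add e₁ e₂ => e₁.vars ∪ e₂.vars
  | _, .sub e₁ e₂ => e₁.vars ∪ e₂.vars
  | _, .tt => ∅
  | _, .ff => ∅
  | _, .not b => b.vars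
  | _, .and b₁ b₂ => b₁.vars ∪ b₂.vars
  | _, .lt e₁ e₂ => e₁.vars ∪ e₂.vars
  | _, .eq e₁ e₂ => e₁.vars ∪ e₂.vars
  | _, .assign x e => {x} ∪ e.vars
  | _, .seq s₁ s₂ => s₁.vars ∪ s₂.vars
  | _, .ite b s₁ s₂ => b.vars ∪ s₁.vars ∪ s₂.vars
  | _, .loop b s => b.vars ∪ s.vars

/-- The variables that occur in some member of a set of terms. -/
def varsOf {τ : Ty} (C : Set (Term τ)) : Set Var := ⋃ c ∈ C, c.vars

/-- The set `while B do S` of all loops with a guard in `B` and a body in `S`. -/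
def loops (B : Set (Term .bexp)) (S : Set (Term .stmt)) : Set (Term .stmt) :=
  {c | ∃ b ∈ B, ∃ s ∈ S, c = .loop b s}

/-- Every member of `C` is a while loop. -/
def IsLoopSet (C : Set (Term .stmt)) : Prop := ∀ c ∈ C, ∃ b s, c = .loop b s

/-! ### Regular tree grammars and inductively defined sets of programs -/

/-- Right-hand sides of productions: a constructor of the language applied to nonterminals of the
appropriate sorts. (A grammar has finitely many productions, so nonterminals that generate
variables can be inlined; a variable therefore stands directly in a right-hand side.) -/
inductive RHS (N : Ty → Type) : Ty → Type
  | var (x : Var) : RHS N .exp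
  | zero : RHS N .exp
  | one : RHS N .exp
  | add (E₁ E₂ : N .exp) : RHS N .exp
  | sub (E₁ E₂ : N .exp) : RHS N .exp
  | tt : RHS N .bexp
  | ff : RHS N .bexp
  | not (B : N .bexp) : RHS N .bexp
  | and (B₁ B₂ : N .bexp) : RHS N .bexp
  | lt (E₁ E₂ : N .exp) : RHS N .bexp
  | eq (E₁ E₂ : N .exp) : RHS N .bexp
  | assign (x : Var) (E : N .exp) : RHS N .stmt
  | seq (S₁ S₂ : N .stmt) : RHS N .stmt
  | ite (B : N .bexp) (S₁ S₂ : N .stmt) : RHS N .stmt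
  | loop (B : N .bexp) (S : N .stmt) : RHS N .stmt

/-- A typed regular tree grammar over the constructors of the language: finitely many nonterminals
of each sort and finitely many productions. The start symbol is chosen in `IsInductive`. -/
structure RTG where
  N : Ty → Type
  finite_N : ∀ τ, Finite (N τ)
  prods : ∀ {τ}, N τ → Set (RHS N τ)
  finite_prods : ∀ {τ} (A : N τ), (prods A).Finite

/-- `G.Derives A t`: the term `t` is derivable from the nonterminal `A`. -/
inductive RTG.Derives (G : RTG) : {τ : Ty} → G.N τ → Term τ → Prop
  | var {A : G.N .exp} {x} : .var x ∈ G.prods A → Derives G A (.var x)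
  | zero {A : G.N .exp} : .zero ∈ G.prods A → Derives G A .zero
  | one {A : G.N .exp} : .one ∈ G.prods A → Derives G A .one
  | add {A E₁ E₂ : G.N .exp} {e₁ e₂} : .add E₁ E₂ ∈ G.prods A →
      Derives G E₁ e₁ → Derives G E₂ e₂ → Derives G A (.add e₁ e₂)
  | sub {A E₁ E₂ : G.N .exp} {e₁ e₂} : .sub E₁ E₂ ∈ G.prods A →
      Derives G E₁ e₁ → Derives G E₂ e₂ → Derives G A (.sub e₁ e₂)
  | tt {A : G.N .bexp} : .tt ∈ G.prods A → Derives G A .tt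
  | ff {A : G.N .bexp} : .ff ∈ G.prods A → Derives G A .ff
  | not {A B : G.N .bexp} {b} : .not B ∈ G.prods A → Derives G B b → Derives G A (.not b)
  | and {A B₁ B₂ : G.N .bexp} {b₁ b₂} : .and B₁ B₂ ∈ G.prods A →
      Derives G B₁ b₁ → Derives G B₂ b₂ → Derives G A (.and b₁ b₂)
  | lt {A : G.N .bexp} {E₁ E₂ : G.N .exp} {e₁ e₂} : .lt E₁ E₂ ∈ G.prods A →
      Derives G E₁ e₁ → Derives G E₂ e₂ → Derives G A (.lt e₁ e₂)
  | eq {A : G.N .bexp} {E₁ E₂ : G.N .exp} {e₁ e₂} : .eq E₁ E₂ ∈ G.prods A →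
      Derives G E₁ e₁ → Derives G E₂ e₂ → Derives G A (.eq e₁ e₂)
  | assign {A : G.N .stmt} {x} {E : G.N .exp} {e} : .assign x E ∈ G.prods A →
      Derives G E e → Derives G A (.assign x e)
  | seq {A S₁ S₂ : G.N .stmt} {s₁ s₂} : .seq S₁ S₂ ∈ G.prods A →
      Derives G S₁ s₁ → Derives G S₂ s₂ → Derives G A (.seq s₁ s₂)
  | ite {A : G.N .stmt} {B : G.N .bexp} {S₁ S₂ : G.N .stmt} {b s₁ s₂} :
      .ite B S₁ S₂ ∈ G.prods A → Derives G B b → Derives G S₁ s₁ → Derives G S₂ s₂ →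
      Derives G A (.ite b s₁ s₂)
  | loop {A : G.N .stmt} {B : G.N .bexp} {S : G.N .stmt} {b s} : .loop B S ∈ G.prods A →
      Derives G B b → Derives G S s → Derives G A (.loop b s)

/-- `C` is inductively defined: it is the language of a nonterminal of a regular tree grammar. -/
def IsInductive {τ : Ty} (C : Set (Term τ)) : Prop :=
  ∃ (G : RTG) (A : G.N τ), C = {t | G.Derives A t}

/-! ### Program-agnostic semantics -/

/-- A state: values of the variables, and the reserved variables `e_t` and `b_t` that hold the
results of integer and Boolean expressions. -/
@[ext]
structure State where
  h : Var → ℤ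
  et : ℤ
  bt : Bool

/-- `Eval c σ σ'`: started in `σ`, the program `c` terminates in `σ'`. Expressions are run as
state transformers that write their value to `e_t` or `b_t`. -/
inductive Eval : {τ : Ty} → Term τ → State → State → Prop
  | var {x σ} : Eval (.var x) σ { σ with et := σ.h x }
  | zero {σ} : Eval .zero σ { σ with et := 0 }
  | one {σ} : Eval .one σ { σ with et := 1 }
  | add {e₁ e₂ σ σ₁ σ₂} : Eval e₁ σ σ₁ → Eval e₂ σ σ₂ →
      Eval (.add e₁ e₂) σ { σ with et := σ₁.et + σ₂.et }
  | sub {e₁ e₂ σ σ₁ σ₂} : Eval e₁ σ σ₁ → Eval e₂ σ σ₂ →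
      Eval (.sub e₁ e₂) σ { σ with et := σ₁.et - σ₂.et }
  | tt {σ} : Eval .tt σ { σ with bt := true }
  | ff {σ} : Eval .ff σ { σ with bt := false }
  | not {b σ σ₁} : Eval b σ σ₁ → Eval (.not b) σ { σ with bt := !σ₁.bt }
  | and {b₁ b₂ σ σ₁ σ₂} : Eval b₁ σ σ₁ → Eval b₂ σ σ₂ →
      Eval (.and b₁ b₂) σ { σ with bt := σ₁.bt && σ₂.bt }
  | lt {e₁ e₂ σ σ₁ σ₂} : Eval e₁ σ σ₁ → Eval e₂ σ σ₂ →
      Eval (.lt e₁ e₂) σ { σ with bt := decide (σ₁.et < σ₂.et) }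
  | eq {e₁ e₂ σ σ₁ σ₂} : Eval e₁ σ σ₁ → Eval e₂ σ σ₂ →
      Eval (.eq e₁ e₂) σ { σ with bt := decide (σ₁.et = σ₂.et) }
  | assign {x e σ σ₁} : Eval e σ σ₁ →
      Eval (.assign x e) σ { σ with h := Function.update σ.h x σ₁.et }
  | seq {s₁ s₂ σ σ₁ σ₂} : Eval s₁ σ σ₁ → Eval s₂ σ₁ σ₂ → Eval (.seq s₁ s₂) σ σ₂
  | ite_true {b s₁ s₂ σ σ₁ σ'} : Eval b σ σ₁ → σ₁.bt = true → Eval s₁ σ σ' →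
      Eval (.ite b s₁ s₂) σ σ'
  | ite_false {b s₁ s₂ σ σ₁ σ'} : Eval b σ σ₁ → σ₁.bt = false → Eval s₂ σ σ' →
      Eval (.ite b s₁ s₂) σ σ'
  | loop_true {b s σ σ₁ σ₂ σ'} : Eval b σ σ₁ → σ₁.bt = true → Eval s σ σ₂ →
      Eval (.loop b s) σ₂ σ' → Eval (.loop b s) σ σ'
  | loop_false {b s σ σ₁} : Eval b σ σ₁ → σ₁.bt = false → Eval (.loop b s) σ σ

/-- States extended by the divergence value `none` (written `↑`). -/
abbrev DState := Option State

/-- Divergence-aware semantics of one program on one (possibly diverged) state: the final state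
if the program terminates, and `↑` otherwise; `↑` is propagated. -/
def EvalD {τ : Ty} (c : Term τ) : DState → DState → Prop
  | some σ, some σ' => Eval c σ σ'
  | some σ, none => ¬ ∃ σ', Eval c σ σ'
  | none, some _ => False
  | none, none => True

/-- A semantics of sets of programs whose denotations transform sets of elements of `X`. -/
abbrev SetSemantics (X : Type) := ∀ τ : Ty, Set (Term τ) → Set X → Set X

/-- The divergence-agnostic program-agnostic semantics of sets of programs. -/
def agnostic : SetSemantics State := fun _ C P => {σ' | ∃ c ∈ C, ∃ σ ∈ P, Eval c σ σ'}

/-- The divergence-aware program-agnostic semantics of sets of programs. -/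
def agnosticD : SetSemantics DState := fun _ C P => {σ' | ∃ c ∈ C, ∃ σ ∈ P, EvalD c σ σ'}

/-! ### Triples, compositional While-rules and derivations -/

universe u

/-- Assertions over `X`: formulas that may mention auxiliary (logical) variables, whose valuations
form the type `Z`. For `Z = Unit` an assertion is a set of states. -/
abbrev Assn (X : Type) (Z : Type u) := Z → Set X

/-- An unrealizability triple `{pre} prog {post}`. -/
structure Triple (X : Type) (Z : Type u) where
  {τ : Ty}
  pre : Assn X Z
  prog : Set (Term τ)
  post : Assn X Z

variable {X : Type} {Z : Type u}

/-- The triple holds under the semantics `A`: `⟦prog⟧(pre) ⊆ post`, for all values of the auxiliary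
variables. -/
def Triple.Holds (A : SetSemantics X) (t : Triple X Z) : Prop :=
  ∀ z, A t.τ t.prog (t.pre z) ⊆ t.post z

/-- The meaning of `Γ ⊢ t`: the triple `t` holds, assuming that all triples in `Γ` hold. -/
def Entails (A : SetSemantics X) (Γ : Set (Triple X Z)) (t : Triple X Z) : Prop :=
  (∀ t' ∈ Γ, t'.Holds A) → t.Holds A

/-- A compositional While-rule, given by its postcondition
`φ (vars B) (vars S) P P_B P_S Q_B Q_S`. -/
abbrev WhileRule (X : Type) (Z : Type u) :=
  Set Var → Set Var → Assn X Z → Assn X Z → Assn X Z → Assn X Z → Assn X Z → Assn X Z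

/-- A structural rule that does not inspect the set of programs `C`: from `Γ ⊢ {P'} C {Q'}` for all
`(P', Q')` in the finite list `premises`, infer `Γ ⊢ {pre} C {post}`. -/
structure StructuralRule (X : Type) (Z : Type u) where
  premises : List (Assn X Z × Assn X Z)
  pre : Assn X Z
  post : Assn X Z

/-- `Derivable A φ R Γ P C Q`: there is a (finite) derivation of `Γ ⊢ {P} C {Q}`. The rules are
the compositional While-rule `φ`, grammar disjunction, weakening, the use of a hypothesis, and the
structural rules in `R`. Derivability is relative: the premises of the While-rule, which concern
guards and bodies, are supplied by an oracle for true judgments. -/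
inductive Derivable (A : SetSemantics X) (φ : WhileRule X Z) (R : Set (StructuralRule X Z)) :
    Set (Triple X Z) → Assn X Z → Set (Term .stmt) → Assn X Z → Prop
  | whileRule {Γ B S P PB PS QB QS} : IsInductive B → IsInductive S →
      Entails A Γ ⟨PB, B, QB⟩ → Entails A Γ ⟨PS, S, QS⟩ →
      Derivable A φ R Γ P (loops B S) (φ (varsOf B) (varsOf S) P PB PS QB QS)
  | grmDisj {Γ C₁ C₂ P Q} : IsInductive C₁ → IsInductive C₂ →
      Derivable A φ R Γ P C₁ Q → Derivable A φ R Γ P C₂ Q → Derivable A φ R Γ P (C₁ ∪ C₂) Q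
  | weaken {Γ C P P' Q Q'} : (∀ z, P' z ⊆ P z) → (∀ z, Q z ⊆ Q' z) →
      Derivable A φ R Γ P C Q → Derivable A φ R Γ P' C Q'
  | hyp {Γ P C Q} : (⟨P, C, Q⟩ : Triple X Z) ∈ Γ → Derivable A φ R Γ P C Q
  | structural {Γ C} (r : StructuralRule X Z) : r ∈ R → IsInductive C → IsLoopSet C →
      (∀ p ∈ r.premises, Derivable A φ R Γ p.1 C p.2) → Derivable A φ R Γ r.pre C r.post

/-- Every derivable judgment is true. -/
def Sound (A : SetSemantics X) (φ : WhileRule X Z) (R : Set (StructuralRule X Z)) : Prop :=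
  ∀ Γ P C Q, Derivable A φ R Γ P C Q → Entails A Γ ⟨P, C, Q⟩

/-- Every true judgment about a set of loops `while B do S`, with `B` and `S` inductively defined,
is derivable (relative to the true judgments about guards and bodies). -/
def RelativelyComplete (A : SetSemantics X) (φ : WhileRule X Z) (R : Set (StructuralRule X Z)) :
    Prop :=
  ∀ Γ P B S Q, IsInductive B → IsInductive S → Entails A Γ ⟨P, loops B S, Q⟩ →
    Derivable A φ R Γ P (loops B S) Q

end Imp

/-! A premise `{P_S} S {Q_S}` only constrains single runs of members of `S`, whereas a loop runs the
same member in every round. With `x₀ = x₁ = 0`, the loop with body `body n` stores `n + 1` in the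
first round, recognizes it in the second, and stops with `x₁ = 1`. But for infinite `S ⊆ Set.range
body`, the program `mixedBody n` (with `body n ∈ S`) agrees on each state with some member of `S`:
when `x₀ ≠ 0`, infinitely many members do not recognize `x₀` and fail (`exists_selects_mixedBody`).
So every true premise about `S` is true of `{mixedBody n}`, whose variables are the same; the
While-rule then gives the same conclusion for its loop, which ends with `x₁ = -1`.

This must survive the other rules. All loops with a mixed body act like the one program `failLoop`,
independently of `n`. By induction on derivations without hypotheses, every triple derived for an
infinite set of loops of the family holds for `{failLoop}` (`Derivable.failLoop_holds`): one part of
an infinite union is infinite, and a sound structural rule may be applied to `{failLoop}` itself.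
Completeness would derive the true triple that the whole family leads from `x₀ = x₁ = 0` to `x₁ =
1`, which `failLoop` violates. -/

namespace Imp

/-! ### Closure properties of inductively defined sets -/

/-- Renaming of the nonterminals of a right-hand side. -/
def RHS.map {N M : Ty → Type} (f : ∀ {τ}, N τ → M τ) : {τ : Ty} → RHS N τ → RHS M τ
  | _, .var x => .var x
  | _, .zero => .zero
  | _, .one => .one
  | _, .add E₁ E₂ => .add (f E₁) (f E₂)
  | _, .sub E₁ E₂ => .sub (f E₁) (f E₂)
  | _, .tt => .tt
  | _, .ff => .ff
  | _, .not B => .not (f B)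
  | _, .and B₁ B₂ => .and (f B₁) (f B₂)
  | _, .lt E₁ E₂ => .lt (f E₁) (f E₂)
  | _, .eq E₁ E₂ => .eq (f E₁) (f E₂)
  | _, .assign x E => .assign x (f E)
  | _, .seq S₁ S₂ => .seq (f S₁) (f S₂)
  | _, .ite B S₁ S₂ => .ite (f B) (f S₁) (f S₂)
  | _, .loop B S => .loop (f B) (f S)

/-- `r.Yields L t`: the term `t` arises from the right-hand side `r` by replacing each nonterminal
`A` with a member of `L A`. -/
inductive RHS.Yields {N : Ty → Type} (L : ∀ {τ}, N τ → Term τ → Prop) :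
    {τ : Ty} → RHS N τ → Term τ → Prop
  | var {x} : Yields L (.var x) (.var x)
  | zero : Yields L .zero .zero
  | one : Yields L .one .one
  | add {E₁ E₂ e₁ e₂} : L E₁ e₁ → L E₂ e₂ → Yields L (.add E₁ E₂) (.add e₁ e₂)
  | sub {E₁ E₂ e₁ e₂} : L E₁ e₁ → L E₂ e₂ → Yields L (.sub E₁ E₂) (.sub e₁ e₂)
  | tt : Yields L .tt .tt
  | ff : Yields L .ff .ff
  | not {B b} : L B b → Yields L (.not B) (.not b)
  | and {B₁ B₂ b₁ b₂} : L B₁ b₁ → L B₂ b₂ → Yields L (.and B₁ B₂) (.and b₁ b₂)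
  | lt {E₁ E₂ e₁ e₂} : L E₁ e₁ → L E₂ e₂ → Yields L (.lt E₁ E₂) (.lt e₁ e₂)
  | eq {E₁ E₂ e₁ e₂} : L E₁ e₁ → L E₂ e₂ → Yields L (.eq E₁ E₂) (.eq e₁ e₂)
  | assign {x E e} : L E e → Yields L (.assign x E) (.assign x e)
  | seq {S₁ S₂ s₁ s₂} : L S₁ s₁ → L S₂ s₂ → Yields L (.seq S₁ S₂) (.seq s₁ s₂)
  | ite {B S₁ S₂ b s₁ s₂} : L B b → L S₁ s₁ → L S₂ s₂ →
      Yields L (.ite B S₁ S₂) (.ite b s₁ s₂)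
  | loop {B S b s} : L B b → L S s → Yields L (.loop B S) (.loop b s)

theorem RHS.yields_map {N M : Ty → Type} (f : ∀ {τ}, N τ → M τ)
    (L : ∀ {τ}, M τ → Term τ → Prop) {τ : Ty} (r : RHS N τ) (t : Term τ) :
    (r.map f).Yields L t ↔ r.Yields (fun A => L (f A)) t := by
  constructor
  · intro h
    cases r <;> simp only [RHS.map] at h <;> cases h <;> constructor <;> assumption
  · intro h
    cases h <;> constructor <;> assumption

theorem RHS.exists_mem_image_map {N M : Ty → Type} (f : ∀ {τ}, N τ → M τ)
    (L : ∀ {τ}, M τ → Term τ → Prop) {τ : Ty} (R : Set (RHS N τ)) (t : Term τ) :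
    (∃ r ∈ RHS.map f '' R, r.Yields L t) ↔ ∃ r ∈ R, r.Yields (fun A => L (f A)) t := by
  simp only [Set.exists_mem_image, RHS.yields_map]

theorem RTG.derives_iff (G : RTG) {τ : Ty} (A : G.N τ) (t : Term τ) :
    G.Derives A t ↔ ∃ r ∈ G.prods A, r.Yields G.Derives t := by
  constructor
  · intro h
    cases h <;> exact ⟨_, ‹_›, by constructor <;> assumption⟩
  · rintro ⟨r, hr, h⟩
    cases h <;> constructor <;> assumption

/-- Every production of a grammar is guarded by a constructor, so that the equations that it
defines have a unique solution. -/
theorem RTG.derives_iff_of_equations (G : RTG) (L : ∀ {τ}, G.N τ → Term τ → Prop)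
    (hL : ∀ {τ} (A : G.N τ) (t : Term τ), L A t ↔ ∃ r ∈ G.prods A, r.Yields L t)
    {τ : Ty} (A : G.N τ) (t : Term τ) : G.Derives A t ↔ L A t := by
  constructor
  · intro h
    induction h <;> exact (hL _ _).2 ⟨_, ‹_›, by constructor <;> assumption⟩
  · intro h
    induction t <;> obtain ⟨r, hr, h⟩ := (hL _ _).1 h <;> cases h
    case var => exact .var hr
    case zero => exact .zero hr
    case one => exact .one hr
    case add ih₁ ih₂ _ _ h₁ h₂ => exact .add hr (ih₁ _ h₁) (ih₂ _ h₂)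
    case sub ih₁ ih₂ _ _ h₁ h₂ => exact .sub hr (ih₁ _ h₁) (ih₂ _ h₂)
    case tt => exact .tt hr
    case ff => exact .ff hr
    case not ih _ h => exact .not hr (ih _ h)
    case and ih₁ ih₂ _ _ h₁ h₂ => exact .and hr (ih₁ _ h₁) (ih₂ _ h₂)
    case lt ih₁ ih₂ _ _ h₁ h₂ => exact .lt hr (ih₁ _ h₁) (ih₂ _ h₂)
    case eq ih₁ ih₂ _ _ h₁ h₂ => exact .eq hr (ih₁ _ h₁) (ih₂ _ h₂)
    case assign ih _ h => exact .assign hr (ih _ h)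
    case seq ih₁ ih₂ _ _ h₁ h₂ => exact .seq hr (ih₁ _ h₁) (ih₂ _ h₂)
    case ite ih₁ ih₂ ih₃ _ _ _ h₁ h₂ h₃ => exact .ite hr (ih₁ _ h₁) (ih₂ _ h₂) (ih₃ _ h₃)
    case loop ih₁ ih₂ _ _ h₁ h₂ => exact .loop hr (ih₁ _ h₁) (ih₂ _ h₂)

/-- The disjoint union of two grammars. -/
def RTG.sum (G H : RTG) : RTG where
  N τ := G.N τ ⊕ H.N τ
  finite_N τ := by
    have := G.finite_N τ
    have := H.finite_N τ
    infer_instance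
  prods
    | .inl A => RHS.map Sum.inl '' G.prods A
    | .inr A => RHS.map Sum.inr '' H.prods A
  finite_prods
    | .inl A => (G.finite_prods A).image _
    | .inr A => (H.finite_prods A).image _

theorem RTG.sum_derives (G H : RTG) {τ : Ty} (A : G.N τ ⊕ H.N τ) (t : Term τ) :
    (G.sum H).Derives A t ↔ Sum.elim (G.Derives · t) (H.Derives · t) A := by
  let L {τ : Ty} (A : G.N τ ⊕ H.N τ) (t : Term τ) : Prop :=
    Sum.elim (G.Derives · t) (H.Derives · t) A
  refine (G.sum H).derives_iff_of_equations L ?_ A t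
  rintro τ (A | A) t
  · exact (G.derives_iff A t).trans (RHS.exists_mem_image_map Sum.inl L _ t).symm
  · exact (H.derives_iff A t).trans (RHS.exists_mem_image_map Sum.inr L _ t).symm

/-- The grammar `G` with a new nonterminal that has the single production `r`. -/
def RTG.extend (G : RTG) {τ : Ty} (r : RHS G.N τ) : RTG where
  N τ := Option (G.N τ)
  finite_N τ := by
    have := G.finite_N τ
    infer_instance
  prods {τ'}
    | some A => RHS.map some '' G.prods A
    -- `none` exists at every sort. The equality in the sigma type gives it the production `r` at
    -- sort `τ` and no production at other sorts.
    | none => RHS.map some '' {r' | (⟨τ', r'⟩ : Σ τ, RHS G.N τ) = ⟨τ, r⟩}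
  finite_prods
    | some A => (G.finite_prods A).image _
    | none => Set.Finite.image _ <| Set.Subsingleton.finite fun r₁ h₁ r₂ h₂ => by
        simpa using h₁.trans h₂.symm

/-- The production of the new nonterminal mentions only old ones, so the old languages are
unchanged. Closure under a constructor reduces to this. -/
theorem isInductive_yields (G : RTG) {τ : Ty} (r : RHS G.N τ) :
    IsInductive {t | r.Yields G.Derives t} := by
  refine ⟨G.extend r, (none : Option (G.N τ)), ?_⟩
  ext t
  let L {τ' : Ty} (A : Option (G.N τ')) (t : Term τ') : Prop := A.elim
    (∃ r', (⟨τ', r'⟩ : Σ τ, RHS G.N τ) = ⟨τ, r⟩ ∧ r'.Yields G.Derives t) (G.Derives · t)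
  refine (((G.extend r).derives_iff_of_equations L ?_ none t).trans ?_).symm
  · rintro τ' (_ | A) t
    · exact (RHS.exists_mem_image_map some L _ t).symm
    · exact (G.derives_iff A t).trans (RHS.exists_mem_image_map some L _ t).symm
  · simp [L]

/-- A production can only combine nonterminals of one grammar; the disjoint union provides it. -/
theorem IsInductive.exists_common {τ₁ τ₂ : Ty} {C₁ : Set (Term τ₁)} {C₂ : Set (Term τ₂)}
    (h₁ : IsInductive C₁) (h₂ : IsInductive C₂) :
    ∃ (G : RTG) (A₁ : G.N τ₁) (A₂ : G.N τ₂), C₁ = {t | G.Derives A₁ t} ∧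
      C₂ = {t | G.Derives A₂ t} := by
  obtain ⟨G, A, rfl⟩ := h₁
  obtain ⟨H, B, rfl⟩ := h₂
  refine ⟨G.sum H, Sum.inl A, Sum.inr B, ?_, ?_⟩ <;> ext t <;> simp [RTG.sum_derives]

theorem IsInductive.exists_common₃ {τ₁ τ₂ τ₃ : Ty} {C₁ : Set (Term τ₁)} {C₂ : Set (Term τ₂)}
    {C₃ : Set (Term τ₃)} (h₁ : IsInductive C₁) (h₂ : IsInductive C₂) (h₃ : IsInductive C₃) :
    ∃ (G : RTG) (A₁ : G.N τ₁) (A₂ : G.N τ₂) (A₃ : G.N τ₃), C₁ = {t | G.Derives A₁ t} ∧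
      C₂ = {t | G.Derives A₂ t} ∧ C₃ = {t | G.Derives A₃ t} := by
  obtain ⟨G, A, B, rfl, rfl⟩ := h₁.exists_common h₂
  obtain ⟨H, C, rfl⟩ := h₃
  refine ⟨G.sum H, Sum.inl A, Sum.inl B, Sum.inr C, ?_, ?_, ?_⟩ <;> ext t <;>
    simp [RTG.sum_derives]

theorem IsInductive.seq {C₁ C₂ : Set (Term .stmt)} (h₁ : IsInductive C₁) (h₂ : IsInductive C₂) :
    IsInductive (Set.image2 Term.seq C₁ C₂) := by
  obtain ⟨G, A₁, A₂, rfl, rfl⟩ := h₁.exists_common h₂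
  convert isInductive_yields G (.seq A₁ A₂) using 1
  ext t
  constructor
  · rintro ⟨_, h₁, _, h₂, rfl⟩
    exact .seq h₁ h₂
  · rintro (_ | _)
    exact ⟨_, ‹_›, _, ‹_›, rfl⟩

theorem IsInductive.assign (x : Var) {C : Set (Term .exp)} (h : IsInductive C) :
    IsInductive (Term.assign x '' C) := by
  obtain ⟨G, A, rfl⟩ := h
  convert isInductive_yields G (.assign x A) using 1
  ext t
  constructor
  · rintro ⟨_, h, rfl⟩
    exact .assign h
  · rintro (_ | _)
    exact ⟨_, ‹_›, rfl⟩

/-! ### Singletons are inductively defined -/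

/-- The grammar without productions. -/
def RTG.empty : RTG where
  N _ := Empty
  finite_N _ := inferInstance
  prods A := A.elim
  finite_prods A := A.elim

theorem RHS.yields_singleton {N : Ty → Type} {L : ∀ {τ}, N τ → Term τ → Prop} {τ : Ty}
    {r : RHS N τ} {c : Term τ} (h : r.Yields (fun {τ} A t => ∀ t', L (τ := τ) A t' ↔ t' = t) c) :
    {t | r.Yields L t} = {c} := by
  ext t
  constructor
  · intro h'
    cases h <;> cases h' <;> simp_all
  · rintro rfl
    cases h <;> constructor <;> simp_all

theorem isInductive_singleton {τ : Ty} (c : Term τ) : IsInductive {c} := by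
  have lang {τ : Ty} {c : Term τ} (h : ∃ (G : RTG) (r : RHS G.N τ),
      r.Yields (fun A t => ∀ t', G.Derives A t' ↔ t' = t) c) : IsInductive {c} := by
    obtain ⟨G, r, h⟩ := h
    exact RHS.yields_singleton h ▸ isInductive_yields G r
  -- In this form, each constructor only needs a grammar with nonterminals whose languages are the
  -- singletons of the immediate subterms.
  suffices h : ∃ (G : RTG) (r : RHS G.N τ),
      r.Yields (fun A t => ∀ t', G.Derives A t' ↔ t' = t) c from lang h
  have key {τ : Ty} {c : Term τ} {G : RTG} {A : G.N τ} (h : {c} = {t | G.Derives A t}) (t) :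
      G.Derives A t ↔ t = c := (Set.ext_iff.1 h t).symm
  induction c with
  | var x => exact ⟨.empty, _, .var⟩
  | zero => exact ⟨.empty, _, .zero⟩
  | one => exact ⟨.empty, _, .one⟩
  | tt => exact ⟨.empty, _, .tt⟩
  | ff => exact ⟨.empty, _, .ff⟩
  | not _ ih =>
    obtain ⟨G, A, h⟩ := lang ih
    exact ⟨G, _, .not (key h)⟩
  | assign _ _ ih =>
    obtain ⟨G, A, h⟩ := lang ih
    exact ⟨G, _, .assign (key h)⟩
  | add _ _ ih₁ ih₂ =>
    obtain ⟨G, A, B, h₁, h₂⟩ := (lang ih₁).exists_common (lang ih₂)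
    exact ⟨G, _, .add (key h₁) (key h₂)⟩
  | sub _ _ ih₁ ih₂ =>
    obtain ⟨G, A, B, h₁, h₂⟩ := (lang ih₁).exists_common (lang ih₂)
    exact ⟨G, _, .sub (key h₁) (key h₂)⟩
  | and _ _ ih₁ ih₂ =>
    obtain ⟨G, A, B, h₁, h₂⟩ := (lang ih₁).exists_common (lang ih₂)
    exact ⟨G, _, .and (key h₁) (key h₂)⟩
  | lt _ _ ih₁ ih₂ =>
    obtain ⟨G, A, B, h₁, h₂⟩ := (lang ih₁).exists_common (lang ih₂)
    exact ⟨G, _, .lt (key h₁) (key h₂)⟩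
  | eq _ _ ih₁ ih₂ =>
    obtain ⟨G, A, B, h₁, h₂⟩ := (lang ih₁).exists_common (lang ih₂)
    exact ⟨G, _, .eq (key h₁) (key h₂)⟩
  | seq _ _ ih₁ ih₂ =>
    obtain ⟨G, A, B, h₁, h₂⟩ := (lang ih₁).exists_common (lang ih₂)
    exact ⟨G, _, .seq (key h₁) (key h₂)⟩
  | loop _ _ ih₁ ih₂ =>
    obtain ⟨G, A, B, h₁, h₂⟩ := (lang ih₁).exists_common (lang ih₂)
    exact ⟨G, _, .loop (key h₁) (key h₂)⟩
  | ite _ _ _ ih₁ ih₂ ih₃ =>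
    obtain ⟨G, A, B, C, h₁, h₂, h₃⟩ := (lang ih₁).exists_common₃ (lang ih₂) (lang ih₃)
    exact ⟨G, _, .ite (key h₁) (key h₂) (key h₃)⟩

/-! ### Numerals -/

/-- The numeral `1 + 1 + ⋯ + 1` of value `n + 1`. -/
def numeral : ℕ → Term .exp
  | 0 => .one
  | n + 1 => .add (numeral n) .one

/-- The productions of a grammar of numerals; the nonterminal `true` generates all numerals and
`false` generates the numeral of value `1`. -/
def numeralProds : {τ : Ty} → Bool → Set (RHS (fun _ => Bool) τ)
  | .exp, true => {.one, .add true false}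
  | .exp, false => {.one}
  | .stmt, _ => ∅
  | .bexp, _ => ∅

/-- The grammar of numerals. -/
def numeralGrammar : RTG where
  N _ := Bool
  finite_N _ := inferInstance
  prods := numeralProds
  finite_prods {τ} A := by cases τ <;> cases A <;> simp [numeralProds]

/-- The languages of the nonterminals of `numeralGrammar`. -/
def numeralLang : {τ : Ty} → Bool → Term τ → Prop
  | .exp, true, t => ∃ n, numeral n = t
  | .exp, false, t => t = .one
  | .stmt, _, _ => False
  | .bexp, _, _ => False

theorem isInductive_range_numeral : IsInductive (Set.range numeral) := by
  refine ⟨numeralGrammar, (true : Bool), ?_⟩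
  ext t
  refine (numeralGrammar.derives_iff_of_equations numeralLang ?_ (true : Bool) t).symm
  rintro (_ | _) (_ | _) t <;> simp only [numeralGrammar, numeralProds, numeralLang]
  case exp.false =>
    constructor
    · rintro rfl
      exact ⟨_, rfl, .one⟩
    · rintro ⟨_, rfl, ⟨⟩⟩
      rfl
  case exp.true =>
    constructor
    · rintro ⟨_ | n, rfl⟩
      · exact ⟨_, .inl rfl, .one⟩
      · exact ⟨_, .inr rfl, .add ⟨n, rfl⟩ rfl⟩
    · rintro ⟨_, rfl | rfl, h⟩
      · cases h
        exact ⟨0, rfl⟩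
      · obtain _ | _ | _ | ⟨⟨n, rfl⟩, rfl⟩ := h
        exact ⟨n + 1, rfl⟩
  -- At the other sorts there are no productions and the languages are empty.
  all_goals exact ⟨False.elim, fun ⟨_, h, _⟩ => h⟩

/-! ### Runs of single programs -/

theorem Eval.det {τ : Ty} {c : Term τ} {σ σ₁ σ₂ : State} (h₁ : Eval c σ σ₁) (h₂ : Eval c σ σ₂) :
    σ₁ = σ₂ := by
  induction h₁ generalizing σ₂ with
  | var | zero | one | tt | ff => cases h₂; rfl
  | not _ ih => obtain ⟨⟩ | ⟨h⟩ := h₂; rw [ih ‹_›]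
  | assign _ ih => cases h₂; rw [ih ‹_›]
  | add _ _ ih₁ ih₂ | sub _ _ ih₁ ih₂ | and _ _ ih₁ ih₂ | lt _ _ ih₁ ih₂ | eq _ _ ih₁ ih₂ =>
    cases h₂; rw [ih₁ ‹_›, ih₂ ‹_›]
  | seq _ _ ih₁ ih₂ =>
    cases h₂ with
    | seq h h' => exact ih₂ (ih₁ h ▸ h')
  | ite_true _ hb _ ih₁ ih₂ =>
    cases h₂ with
    | ite_true _ _ h' => exact ih₂ h'
    | ite_false h hb' _ => rw [ih₁ h, hb'] at hb; cases hb
  | ite_false _ hb _ ih₁ ih₂ =>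
    cases h₂ with
    | ite_true h hb' _ => rw [ih₁ h, hb'] at hb; cases hb
    | ite_false _ _ h' => exact ih₂ h'
  | loop_true _ hb _ _ ih₁ ih₂ ih₃ =>
    cases h₂ with
    | loop_true _ _ h h' => exact ih₃ (ih₂ h ▸ h')
    | loop_false h hb' => rw [ih₁ h, hb'] at hb; cases hb
  | loop_false _ hb ih₁ =>
    cases h₂ with
    | loop_true h hb' _ _ => rw [ih₁ h, hb'] at hb; cases hb
    | loop_false _ _ => rfl

/-- The program `c` is total, and on every state it behaves like some member of `C`. -/
def Selects {τ : Ty} (c : Term τ) (C : Set (Term τ)) : Prop :=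
  ∀ σ, ∃ σ', Eval c σ σ' ∧ ∃ d ∈ C, Eval d σ σ'

theorem Selects.eval {τ : Ty} {c : Term τ} {C : Set (Term τ)} (h : Selects c C) {σ σ' : State}
    (hc : Eval c σ σ') : ∃ d ∈ C, Eval d σ σ' := by
  obtain ⟨σ₁, h₁, hd⟩ := h σ
  rwa [hc.det h₁]

theorem Eval.evalD_iff {τ : Ty} {c : Term τ} {σ σ₁ : State} (h : Eval c σ σ₁) (σ' : DState) :
    EvalD c (some σ) σ' ↔ σ' = some σ₁ := by
  cases σ' with
  | none => simpa [EvalD] using ⟨_, h⟩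
  | some σ' =>
    simp only [EvalD, Option.some.injEq]
    exact ⟨fun h' => h'.det h, fun e => e ▸ h⟩

theorem Selects.evalD {τ : Ty} {c : Term τ} {C : Set (Term τ)} (h : Selects c C) {σ σ' : DState}
    (hc : EvalD c σ σ') : ∃ d ∈ C, EvalD d σ σ' := by
  cases σ with
  | none =>
    -- On input `↑` any member of `C` will do; an arbitrary state shows that there is one.
    obtain ⟨-, -, d, hd, -⟩ := h ⟨0, 0, false⟩
    cases σ' with
    | none => exact ⟨d, hd, trivial⟩
    | some _ => exact hc.elim
  | some σ =>
    obtain ⟨σ₁, h₁, d, hd, h₂⟩ := h σ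
    exact ⟨d, hd, (h₂.evalD_iff _).2 ((h₁.evalD_iff _).1 hc)⟩

/-! ### A family of loops whose bodies can be mixed -/

/-- The state `σ` with the values `a`, `b`, `c` of the variables `x₀`, `x₁`, `x₂`. -/
def State.set₃ (σ : State) (a b c : ℤ) : State :=
  { σ with h := Function.update (Function.update (Function.update σ.h 0 a) 1 b) 2 c }

/-- The guard `x₁ == 0`. -/
def guard : Term .bexp := .eq (.var 1) .zero

/-- The program `x₂ := e; (if x₀ == 0 then x₀ := x₂ else s; x₀ := 0); x₂ := 0`. -/
def phases (s : Term .stmt) (e : Term .exp) : Term .stmt :=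
  .seq (.assign 2 e) (.seq
    (.ite (.eq (.var 0) .zero) (.assign 0 (.var 2)) (.seq s (.assign 0 .zero)))
    (.assign 2 .zero))

/-- The statement `x₁ := -1`. -/
def fail : Term .stmt := .assign 1 (.sub .zero .one)

/-- The statement `if x₀ == x₂ then x₁ := 1 else x₁ := -1`. -/
def test : Term .stmt := .ite (.eq (.var 0) (.var 2)) (.assign 1 .one) fail

/-- The body that first stores the number `n + 1` in `x₀`, and compares `x₀` with this number when
it is run again. -/
def body (n : ℕ) : Term .stmt := phases test (numeral n)

/-- The body that first stores the number `n + 1` in `x₀`, and reports failure when it is run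
again. -/
def mixedBody (n : ℕ) : Term .stmt := phases fail (numeral n)

/-- A loop that reports failure at once. -/
def failLoop : Term .stmt :=
  .loop guard (.seq fail (.seq (.assign 0 .zero) (.assign 2 .zero)))

theorem vars_numeral (n : ℕ) : (numeral n).vars = ∅ := by
  induction n with
  | zero => rfl
  | succ n ih => simp [numeral, Term.vars, ih]

theorem vars_body (n : ℕ) : (body n).vars = {0, 1, 2} := by
  ext x
  simp [body, phases, test, fail, Term.vars, vars_numeral]
  tauto

/-- Since `φ` sees the variables of the body, the mixed body must have exactly those of the family.
-/
theorem vars_mixedBody (n : ℕ) : (mixedBody n).vars = {0, 1, 2} := by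
  ext x
  simp [mixedBody, phases, fail, Term.vars, vars_numeral]
  tauto

theorem numeral_injective : Function.Injective numeral := by
  intro m n h
  induction m generalizing n with
  | zero => cases n <;> simp_all [numeral]
  | succ m ih =>
    cases n with
    | zero => simp [numeral] at h
    | succ n => rw [ih (Term.add.inj h).1]

/-- The number enters only through the first assignment, so the family consists of all numerals
followed by a fixed tail. Using `n` at two places would require a grammar to generate equal
subterms. -/
theorem isInductive_range_body : IsInductive (Set.range body) := by
  convert (isInductive_range_numeral.assign 2).seq (isInductive_singleton _) using 1
  ext t
  simp [body, phases]
  rfl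

/-! ### Runs of the bodies and of their loops -/

theorem eval_numeral (n : ℕ) (σ : State) : Eval (numeral n) σ { σ with et := n + 1 } := by
  induction n with
  | zero => simpa [numeral] using Eval.one
  | succ n ih => simpa [numeral] using Eval.add ih Eval.one

theorem eval_guard (σ : State) : Eval guard σ { σ with bt := decide (σ.h 1 = 0) } := .eq .var .zero

theorem eval_fail (σ : State) : Eval fail σ { σ with h := Function.update σ.h 1 (-1) } := by
  simpa [fail] using Eval.assign (σ := σ) (.sub .zero .one)

theorem eval_test (σ : State) :
    Eval test σ { σ with h := Function.update σ.h 1 (if σ.h 0 = σ.h 2 then 1 else -1) } := by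
  by_cases h : σ.h 0 = σ.h 2
  · exact .ite_true (.eq .var .var) (by simpa using h) (by simpa [h] using Eval.assign .one)
  · exact .ite_false (.eq .var .var) (by simpa using h) (by simpa [h] using eval_fail σ)

/-- The result does not depend on `s`: in this phase `body n` and `mixedBody n` agree. -/
theorem eval_phases_of_eq_zero (s : Term .stmt) (n : ℕ) {σ : State} (h : σ.h 0 = 0) :
    Eval (phases s (numeral n)) σ (σ.set₃ (n + 1) (σ.h 1) 0) := by
  have : Eval (phases s (numeral n)) σ _ := .seq (.assign (x := 2) (eval_numeral n σ)) <|
    .seq (.ite_true (s₂ := .seq s (.assign 0 .zero)) (.eq (.var (x := 0)) .zero) (by simpa using h)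
      (.assign (x := 0) (.var (x := 2)))) (.assign (x := 2) .zero)
  convert this using 1
  ext x <;> simp [State.set₃, Function.update_apply]
  split_ifs <;> simp_all

theorem eval_phases_of_ne_zero {s : Term .stmt} {n : ℕ} {v : ℤ} {σ : State}
    (hs : ∀ σ' : State, σ'.h 0 = σ.h 0 → σ'.h 2 = n + 1 →
      Eval s σ' { σ' with h := Function.update σ'.h 1 v }) (h : σ.h 0 ≠ 0) :
    Eval (phases s (numeral n)) σ (σ.set₃ 0 v 0) := by
  have : Eval (phases s (numeral n)) σ _ := .seq (.assign (x := 2) (eval_numeral n σ)) <|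
    .seq (.ite_false (s₁ := .assign 0 (.var 2)) (.eq (.var (x := 0)) .zero) (by simpa using h)
      (.seq (hs _ (by simp) (by simp)) (.assign (x := 0) .zero))) (.assign (x := 2) .zero)
  convert this using 1
  ext x <;> simp [State.set₃, Function.update_apply]
  split_ifs <;> simp_all

theorem eval_body_of_ne_zero (n : ℕ) {σ : State} (h : σ.h 0 ≠ 0) :
    Eval (body n) σ (σ.set₃ 0 (if σ.h 0 = n + 1 then 1 else -1) 0) :=
  eval_phases_of_ne_zero (fun σ' h₀ h₂ => by simpa [h₀, h₂] using eval_test σ') h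

theorem eval_mixedBody_of_ne_zero (n : ℕ) {σ : State} (h : σ.h 0 ≠ 0) :
    Eval (mixedBody n) σ (σ.set₃ 0 (-1) 0) :=
  eval_phases_of_ne_zero (fun σ' _ _ => eval_fail σ') h

theorem eval_loop_guard_of_ne_zero (s : Term .stmt) {σ : State} (h : σ.h 1 ≠ 0) :
    Eval (.loop guard s) σ σ :=
  .loop_false (eval_guard σ) (by simpa using h)

theorem Eval.loop_guard {s : Term .stmt} {σ σ₁ σ₂ : State} (h : σ.h 1 = 0) (h₁ : Eval s σ σ₁)
    (h₂ : Eval (.loop guard s) σ₁ σ₂) : Eval (.loop guard s) σ σ₂ :=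
  .loop_true (eval_guard σ) (by simpa using h) h₁ h₂

theorem eval_failLoop {σ : State} (h : σ.h 1 = 0) : Eval failLoop σ (σ.set₃ 0 (-1) 0) := by
  refine .loop_guard h ?_ (eval_loop_guard_of_ne_zero _ (by simp [State.set₃]))
  have := Eval.seq (eval_fail σ) (.seq (.assign (x := 0) .zero) (.assign (x := 2) .zero))
  convert this using 1
  ext x <;> simp [State.set₃, Function.update_apply]
  split_ifs <;> simp_all

theorem eval_loop_body (n : ℕ) {σ : State} (h₀ : σ.h 0 = 0) (h₁ : σ.h 1 = 0) :
    Eval (.loop guard (body n)) σ (σ.set₃ 0 1 0) := by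
  -- The stored number is nonzero, so the second round enters the other phase; this is why numerals
  -- start at `1`.
  have hn : (n : ℤ) + 1 ≠ 0 := by positivity
  refine .loop_guard h₁ (eval_phases_of_eq_zero _ n h₀) (.loop_guard (by simpa [State.set₃])
    (eval_body_of_ne_zero n (by simpa [State.set₃])) ?_)
  simpa [State.set₃, Function.update_comm] using
    eval_loop_guard_of_ne_zero (body n) (σ := σ.set₃ 0 1 0) (by simp [State.set₃])

/-- From `x₀ = 0` there are two rounds, otherwise one. Resetting `x₀` and `x₂` makes the final state
the same in both cases and independent of `n`. -/
theorem eval_loop_mixedBody (n : ℕ) {σ : State} (h : σ.h 1 = 0) :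
    Eval (.loop guard (mixedBody n)) σ (σ.set₃ 0 (-1) 0) := by
  have hn : (n : ℤ) + 1 ≠ 0 := by positivity
  have hexit := eval_loop_guard_of_ne_zero (mixedBody n) (σ := σ.set₃ 0 (-1) 0)
    (by simp [State.set₃])
  by_cases h₀ : σ.h 0 = 0
  · refine .loop_guard h (eval_phases_of_eq_zero _ n h₀) (.loop_guard (by simpa [State.set₃])
      (eval_mixedBody_of_ne_zero n (by simpa [State.set₃])) ?_)
    simpa [State.set₃, Function.update_comm] using hexit
  · exact .loop_guard h (eval_mixedBody_of_ne_zero n h₀) hexit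

/-! ### Selection -/

theorem selects_failLoop (n : ℕ) : Selects failLoop {.loop guard (mixedBody n)} := by
  intro σ
  by_cases h : σ.h 1 = 0
  · exact ⟨_, eval_failLoop h, _, rfl, eval_loop_mixedBody n h⟩
  · exact ⟨_, eval_loop_guard_of_ne_zero _ h, _, rfl, eval_loop_guard_of_ne_zero _ h⟩

/-- The member that is imitated depends on the state: when `x₀ = 0` it is a fixed `body n ∈ S`, and
when `x₀ ≠ 0` it is one whose number differs from `x₀`, which therefore fails. -/
theorem exists_selects_mixedBody {S : Set (Term .stmt)} (hS : S ⊆ Set.range body)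
    (hinf : S.Infinite) : ∃ n, Selects (mixedBody n) S := by
  obtain ⟨_, hn⟩ := hinf.nonempty
  obtain ⟨n, rfl⟩ := hS hn
  refine ⟨n, fun σ => ?_⟩
  by_cases h : σ.h 0 = 0
  · exact ⟨_, eval_phases_of_eq_zero _ n h, _, hn, eval_phases_of_eq_zero _ n h⟩
  · refine ⟨_, eval_mixedBody_of_ne_zero n h, ?_⟩
    -- If `x₀ = m + 1`, then `m = (x₀ - 1).toNat`. For negative `x₀` no body matches, and removing
    -- one is harmless.
    obtain ⟨_, hm, hne⟩ := (hinf.sdiff (Set.finite_singleton (body (σ.h 0 - 1).toNat))).nonempty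
    obtain ⟨m, rfl⟩ := hS hm
    have hm' : σ.h 0 ≠ m + 1 := by
      rintro h
      exact hne (by simp [h])
    exact ⟨_, hm, by simpa [hm'] using eval_body_of_ne_zero m h⟩

theorem infinite_loops_range_body : (loops {guard} (Set.range body)).Infinite := by
  refine Set.infinite_of_injective_forall_mem (f := fun n => Term.loop guard (body n)) ?_
    fun n => ⟨_, rfl, _, ⟨n, rfl⟩, rfl⟩
  intro m n h
  simp only [body, phases, Term.loop.injEq, Term.seq.injEq, Term.assign.injEq] at h
  exact numeral_injective h.2.1.2

theorem varsOf_eq_of_subset {S : Set (Term .stmt)} (hS : S ⊆ Set.range body) (hne : S.Nonempty) :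
    varsOf S = {0, 1, 2} := by
  have h : ∀ c ∈ S, c.vars = {0, 1, 2} := fun c hc => by
    obtain ⟨n, rfl⟩ := hS hc
    exact vars_body n
  rw [varsOf, Set.iUnion₂_congr h, Set.biUnion_const hne]

/-! ### Derivations about infinite sets of loops -/

universe u

/-- The semantics of sets of programs induced by the semantics `E` of single programs. -/
def liftSemantics {X : Type} (E : ∀ {τ : Ty}, Term τ → X → X → Prop) : SetSemantics X :=
  fun _ C P => {σ' | ∃ c ∈ C, ∃ σ ∈ P, E c σ σ'}

/-- The premises need not be derivable for `C`, but the rule is available for every `Γ`: they are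
taken as hypotheses, and soundness is applied to the resulting derivation. -/
theorem structural_holds {X : Type} {Z : Type u} {A : SetSemantics X} {φ : WhileRule X Z}
    {R : Set (StructuralRule X Z)} (hs : Sound A φ R) {r : StructuralRule X Z} (hr : r ∈ R)
    {C : Set (Term .stmt)} (hC : IsInductive C) (hl : IsLoopSet C)
    (h : ∀ p ∈ r.premises, (⟨p.1, C, p.2⟩ : Triple X Z).Holds A) :
    (⟨r.pre, C, r.post⟩ : Triple X Z).Holds A := by
  refine hs {t | ∃ p ∈ r.premises, t = ⟨p.1, C, p.2⟩} _ _ _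
    (.structural r hr hC hl fun p hp => .hyp ⟨p, hp, rfl⟩) ?_
  rintro _ ⟨p, hp, rfl⟩
  exact h p hp

variable {X : Type} {Z : Type u} {E : ∀ {τ : Ty}, Term τ → X → X → Prop}

theorem Triple.Holds.of_selects
    (hE : ∀ {τ : Ty} {c : Term τ} {C : Set (Term τ)}, Selects c C → ∀ {σ σ'}, E c σ σ' →
      ∃ d ∈ C, E d σ σ')
    {τ : Ty} {P Q : Assn X Z} {c : Term τ} {C : Set (Term τ)} (hc : Selects c C)
    (h : (⟨P, C, Q⟩ : Triple X Z).Holds (liftSemantics E)) :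
    (⟨P, {c}, Q⟩ : Triple X Z).Holds (liftSemantics E) := by
  rintro z σ' ⟨c', hc', σ, hσ, hr⟩
  have hc₁ : Selects c' C := (hc' : c' = c) ▸ hc
  obtain ⟨d, hd, hr'⟩ := hE hc₁ hr
  exact h z ⟨d, hd, σ, hσ, hr'⟩

theorem Triple.Holds.mono {τ : Ty}
    {P P' Q Q' : Assn X Z} {C : Set (Term τ)}
    (h : (⟨P, C, Q⟩ : Triple X Z).Holds (liftSemantics E)) (hP : ∀ z, P' z ⊆ P z)
    (hQ : ∀ z, Q z ⊆ Q' z) : (⟨P', C, Q'⟩ : Triple X Z).Holds (liftSemantics E) := by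
  rintro z σ' ⟨c, hc, σ, hσ, hr⟩
  exact hQ z (h z ⟨c, hc, σ, hP z hσ, hr⟩)

/-- Derivations may change the set of loops, so the induction ranges over all infinite subsets of
the family. The conclusion concerns one program, not a mixed body that depends on the derivation, so
that all premises of a structural rule hold for a common set. -/
theorem Derivable.failLoop_holds
    (hE : ∀ {τ : Ty} {c : Term τ} {C : Set (Term τ)}, Selects c C → ∀ {σ σ'}, E c σ σ' →
      ∃ d ∈ C, E d σ σ')
    {φ : WhileRule X Z} {R : Set (StructuralRule X Z)} (hs : Sound (liftSemantics E) φ R)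
    {P Q : Assn X Z} {C : Set (Term .stmt)}
    (h : Derivable (liftSemantics E) φ R ∅ P C Q) (hC : C ⊆ loops {guard} (Set.range body))
    (hinf : C.Infinite) : (⟨P, {failLoop}, Q⟩ : Triple X Z).Holds (liftSemantics E) := by
  induction h with
  | @whileRule B S P PB PS QB QS hBi hSi hB hS =>
    obtain ⟨_, b, hb, s, hsS, rfl⟩ := hinf.nonempty
    -- The set of loops determines `B` and bounds `S`, because both are nonempty.
    have hBe : B = {guard} := by
      refine Set.eq_singleton_iff_nonempty_unique_mem.2 ⟨⟨b, hb⟩, fun b' hb' => ?_⟩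
      obtain ⟨_, rfl, _, _, h⟩ := hC ⟨b', hb', s, hsS, rfl⟩
      exact (Term.loop.inj h).1
    subst hBe
    have hSsub : S ⊆ Set.range body := fun s' hs' => by
      obtain ⟨_, _, _, hs'', h⟩ := hC ⟨b, hb, s', hs', rfl⟩
      exact (Term.loop.inj h).2 ▸ hs''
    have hSinf : S.Infinite := by
      refine Set.Infinite.of_image (Term.loop guard) (hinf.mono ?_)
      rintro _ ⟨_, rfl, s', hs', rfl⟩
      exact ⟨s', hs', rfl⟩
    obtain ⟨n, hn⟩ := exists_selects_mixedBody hSsub hSinf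
    have hvars : varsOf S = varsOf {mixedBody n} := by
      rw [varsOf_eq_of_subset hSsub ⟨s, hsS⟩]
      simp [varsOf, vars_mixedBody]
    -- The same instance of the rule, with `S` replaced by `{mixedBody n}`: the premise on bodies
    -- carries over by selection, and soundness makes the conclusion true.
    have hh := hs ∅ _ _ _ (.whileRule (P := P) hBi (isInductive_singleton (mixedBody n)) hB
      fun h => (hS h).of_selects hE hn) (by simp)
    rw [hvars]
    refine Triple.Holds.of_selects hE (fun σ => ?_) hh
    obtain ⟨σ', h₁, _, rfl, h₂⟩ := selects_failLoop n σ
    exact ⟨σ', h₁, _, ⟨_, rfl, _, rfl, rfl⟩, h₂⟩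
  | grmDisj _ _ _ _ ih₁ ih₂ =>
    obtain h | h := Set.infinite_union.1 hinf
    · exact ih₁ (Set.subset_union_left.trans hC) h
    · exact ih₂ (Set.subset_union_right.trans hC) h
  | weaken hP hQ _ ih => exact (ih hC hinf).mono hP hQ
  | hyp h =>
    exact h.elim
  | structural r hr _ _ _ ih =>
    refine structural_holds hs hr (isInductive_singleton _) ?_ fun p hp => ih p hp hC hinf
    rintro _ rfl
    exact ⟨_, _, rfl⟩

/-- Both semantics are treated at once: `ι` embeds states into the values of the semantics, `hE'`
says that terminating runs have exactly their usual result, and `hE` transfers runs along selection.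
-/
theorem not_sound_and_relativelyComplete [Nonempty Z]
    (hE : ∀ {τ : Ty} {c : Term τ} {C : Set (Term τ)}, Selects c C → ∀ {σ σ'}, E c σ σ' →
      ∃ d ∈ C, E d σ σ')
    (ι : State → X) (hι : Function.Injective ι)
    (hE' : ∀ {τ : Ty} {c : Term τ} {σ σ₁}, Eval c σ σ₁ → ∀ σ', E c (ι σ) σ' ↔ σ' = ι σ₁)
    (φ : WhileRule X Z) (R : Set (StructuralRule X Z)) :
    ¬ (Sound (liftSemantics E) φ R ∧ RelativelyComplete (liftSemantics E) φ R) := by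
  rintro ⟨hs, hc⟩
  obtain ⟨z⟩ := ‹Nonempty Z›
  have h := hc ∅ (fun _ => ι '' {σ | σ.h 0 = 0 ∧ σ.h 1 = 0}) {guard} (Set.range body)
    (fun _ => ι '' {σ | σ.h 1 = 1}) (isInductive_singleton _) isInductive_range_body ?_
  -- From the zero state, `failLoop` ends with `x₁ = -1`, against the postcondition `x₁ = 1`.
  · obtain ⟨σ', hσ', h'⟩ := h.failLoop_holds hE hs subset_rfl infinite_loops_range_body z
      ⟨failLoop, rfl, ι ⟨0, 0, false⟩, ⟨_, ⟨rfl, rfl⟩, rfl⟩, (hE' (eval_failLoop rfl) _).2 rfl⟩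
    rw [hι h'] at hσ'
    simp [State.set₃] at hσ'
  · rintro - z σ' ⟨_, ⟨_, rfl, _, ⟨n, rfl⟩, rfl⟩, _, ⟨σ, ⟨h₀, h₁⟩, rfl⟩, h⟩
    rw [hE' (eval_loop_body n h₀ h₁)] at h
    exact ⟨_, by simp [State.set₃], h.symm⟩

end Imp

theorem mainTheorem4 (Z : Type*) [Nonempty Z] :
    (¬ ∃ (φ : Imp.WhileRule Imp.State Z) (R : Set (Imp.StructuralRule Imp.State Z)),
        Imp.Sound Imp.agnostic φ R ∧ Imp.RelativelyComplete Imp.agnostic φ R) ∧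
    (¬ ∃ (φ : Imp.WhileRule Imp.DState Z) (R : Set (Imp.StructuralRule Imp.DState Z)),
        Imp.Sound Imp.agnosticD φ R ∧ Imp.RelativelyComplete Imp.agnosticD φ R) := by
  constructor
  · rintro ⟨φ, R, h⟩
    exact Imp.not_sound_and_relativelyComplete (E := Imp.Eval) (fun hc _ _ => hc.eval) id
      Function.injective_id
      (fun h σ' => ⟨fun h' => h'.det h, fun e => e ▸ h⟩) φ R h
  · rintro ⟨φ, R, h⟩
    exact Imp.not_sound_and_relativelyComplete (E := Imp.EvalD) (fun hc _ _ => hc.evalD) some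
      (Option.some_injective _) (fun h => h.evalD_iff) φ R h
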